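/- Notation. Let $\mathbb N=\{0,1,2,\dots\}$ and let $\mathbf M=(M_p)_{p\in\mathbb N}$ be a sequence of positive real numbers. Put $\mu_0:=1$, $\mu_p:=M_p/M_{p-1}$ for $p\ge1$, $m_p:=M_p/p!$ and $M^*_p:=p!/M_p$, so that $\mathbf M^*=(M_p^*)_p$ is the conjugate sequence; the same notation is used for other sequences. $\mathbf M$ is a weight sequence if $\lim_{p\to\infty}M_p^{1/p}=+\infty$; it is log-convex if $M_p^2\le M_{p-1}M_{p+1}$ for all $p\ge1$ and log-concave if $M_p^2\ge M_{p-1}M_{p+1}$ for all $p\ge 1$. $\mathcal{LC}$ is the set of log-convex weight sequences with $1=M_0\le M_1$. Write $\mathbf M\approx\mathbf N$ if $\sup_{p\ge1}(M_p/N_p)^{1/p}<\infty$ and $\sup_{p\ge1}(N_p/M_p)^{1/p}<\infty$. The upper Matuszewska index of $\mu$ is $$\alpha(\mu):=\inf\Big\{\alpha\in\mathbb R:\ \exists H\ge1\ \forall\,1\le p\le q:\ \frac{\mu_q}{q^{\alpha}}\le H\frac{\mu_p}{p^{\alpha}}\Big\}\in[-\infty,+\infty].$$ For $t\ge0$ let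 $\omega_{\mathbf M}(t):=\sup_{p\in\mathbb N}\log\frac{M_0t^p}{M_p}$ (with $0^0=1$, $\log0=-\infty$), and for $\omega:[0,\infty)\to[0,\infty)$ let $\omega^*(s):=\sup_{t\ge0}\{st-\omega(t)\}$, $s\ge0$. Write $\omega^*_{\mathbf M}:=(\omega_{\mathbf M})^*$. A function $\omega$ is a well-defined weight function if it takes values in $[0,\infty)$, is non-decreasing and tends to $+\infty$ at $+\infty$. It satisfies $(\omega_1)$ if there is $L\ge1$ with $\omega(2t)\le L(\omega(t)+1)$ for all $t\ge0$. Two weight functions $\sigma,\tau$ are equivalent, $\sigma\sim\tau$, if $\sigma(t)=O(\tau(t))$ and $\tau(t)=O(\sigma(t))$ as $t\to+\infty$. Statement. Let $\mathbf M$ be a log-convex weight sequence with $\lim_{p\to\infty}(m_p)^{1/p}=0$ and $\alpha(\mu)<1$. Then: 1. There is $H\ge1$ such that $$\frac{\mu_q}{q}\le H\frac{\mu_p}{p}\quad\text{for all }1\le p\le q.\tag{1}$$ For every $H\ge1$ satisfying (1), put $\lambda_0:=1$, $\lambda_p:=H^{-1}p\sup_{q\ge p}\frac{\mu_q}{q}$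 for $p\ge1$, and $L_p:=\prod_{i=0}^p\lambda_i$. Then $L_0=1$; the sequence $\mathbf l=(L_p/p!)_p$ is log-concave and $p\mapsto\lambda_p/p$ is non-increasing on $p\ge1$; $\mathbf M\approx\mathbf L$; $\lim_{p\to\infty}(l_p)^{1/p}=0$; and $\mathbf L$ is a log-convex weight sequence. Moreover, there is a sequence $\widetilde{\mathbf L}$, whose quotients satisfy $\widetilde\lambda_p=\lambda_p$ for all but finitely many $p$, such that $\widetilde L_0=\widetilde L_1=1$, $\widetilde{\mathbf l}$ is log-concave, $\mathbf M\approx\widetilde{\mathbf L}$, and $\widetilde{\mathbf L},\widetilde{\mathbf L}^*\in\mathcal{LC}$. 2. Both $\omega^*_{\mathbf M}$ and $\omega_{\mathbf M^*}$ are well-defined weight functions and satisfy $(\omega_1)$. 3. $\omega_{\mathbf M^*}\sim\omega^*_{\mathbf M}$. 4. $\mathbf M$ has moderate growth: there is $C\ge1$ with $M_{p+q}\le C^{p+q+1}M_pM_q$ for all $p,q\in\mathbb N$. -/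

import Mathlib

open Filter Topology
open scoped NNReal

namespace ConjWeight

noncomputable section

/-! ### Sequences -/

/-- `μ 0 = 1` and `μ p = M p / M (p - 1)` for `p ≥ 1`. -/
def quot (M : ℕ → ℝ) : ℕ → ℝ
  | 0 => 1
  | p + 1 => M (p + 1) / M p

/-- `m p = M p / p!`. -/
def lower (M : ℕ → ℝ) (p : ℕ) : ℝ := M p / (Nat.factorial p : ℝ)

/-- The conjugate sequence `p! / M p`. -/
def conjSeq (M : ℕ → ℝ) (p : ℕ) : ℝ := (Nat.factorial p : ℝ) / M p

/-- A sequence of positive reals whose `p`-th roots tend to `+∞`. -/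
def IsWeightSequence (M : ℕ → ℝ) : Prop :=
  (∀ p, 0 < M p) ∧ Tendsto (fun p : ℕ => M p ^ ((1 : ℝ) / p)) atTop atTop

def LogConvex (M : ℕ → ℝ) : Prop :=
  ∀ p : ℕ, 1 ≤ p → M p ^ 2 ≤ M (p - 1) * M (p + 1)

def LogConcave (M : ℕ → ℝ) : Prop :=
  ∀ p : ℕ, 1 ≤ p → M (p - 1) * M (p + 1) ≤ M p ^ 2

def ModerateGrowth (M : ℕ → ℝ) : Prop :=
  ∃ C : ℝ, 1 ≤ C ∧ ∀ p q : ℕ, M (p + q) ≤ C ^ (p + q + 1) * M p * M q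

/-- Normalized, log-convex weight sequences. -/
def InLC (M : ℕ → ℝ) : Prop :=
  IsWeightSequence M ∧ LogConvex M ∧ M 0 = 1 ∧ 1 ≤ M 1

/-- `sup_{p ≥ 1} (M p / N p)^(1/p) < ∞`. -/
def SeqLE (M N : ℕ → ℝ) : Prop :=
  BddAbove {x : ℝ | ∃ p : ℕ, 1 ≤ p ∧ x = (M p / N p) ^ ((1 : ℝ) / p)}

def SeqEquiv (M N : ℕ → ℝ) : Prop := SeqLE M N ∧ SeqLE N M

/-- `a q / q^α ≤ H * (a p / p^α)` for all `1 ≤ p ≤ q`. -/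
def AlmostDecreasingWith (a : ℕ → ℝ) (α H : ℝ) : Prop :=
  ∀ p q : ℕ, 1 ≤ p → p ≤ q → a q / (q : ℝ) ^ α ≤ H * (a p / (p : ℝ) ^ α)

/-- The upper Matuszewska index, an infimum in the extended reals (so `inf ∅ = +∞`). -/
def upperMatuszewska (a : ℕ → ℝ) : EReal :=
  sInf {x : EReal | ∃ α : ℝ, x = (α : EReal) ∧ ∃ H : ℝ, 1 ≤ H ∧ AlmostDecreasingWith a α H}

/-- `λ 0 = 1` and `λ p = H⁻¹ * p * sup_{q ≥ p} μ q / q` for `p ≥ 1`. -/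
def regQuot (M : ℕ → ℝ) (H : ℝ) (p : ℕ) : ℝ :=
  if p = 0 then 1 else H⁻¹ * p * ⨆ q : {q : ℕ // p ≤ q}, quot M q / ((q : ℕ) : ℝ)

/-- `L p = λ 0 * λ 1 * ⋯ * λ p`. -/
def regSeq (M : ℕ → ℝ) (H : ℝ) (p : ℕ) : ℝ :=
  ∏ i ∈ Finset.range (p + 1), regQuot M H i

/-! ### Weight functions -/

/-- A well-defined weight function: an extended-real-valued function on `[0, +∞)` whose values all
lie in `[0, +∞)`, which is non-decreasing and tends to `+∞`. -/
def IsWeightFunction (f : ℝ≥0 → EReal) : Prop :=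
  (∀ t, 0 ≤ f t ∧ f t < ⊤) ∧ Monotone f ∧ Tendsto f atTop (𝓝 ⊤)

/-- `sup_p log (M 0 * t^p / M p)`, where `log 0 = -∞` and `0^0 = 1`. -/
def assocFun (M : ℕ → ℝ) (t : ℝ≥0) : EReal :=
  ⨆ p : ℕ, ENNReal.log (ENNReal.ofReal (M 0 * (t : ℝ) ^ p / M p))

/-- The conjugate function `sup_{t ≥ 0} (s * t - f t)`. -/
def conjFun (f : ℝ≥0 → EReal) (s : ℝ≥0) : EReal :=
  ⨆ t : ℝ≥0, (((s : ℝ) * (t : ℝ) : ℝ) : EReal) - f t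

/-- `∃ L ≥ 1, ∀ t ≥ 0, f (2 t) ≤ L (f t + 1)`. -/
def Omega1 (f : ℝ≥0 → EReal) : Prop :=
  ∃ L : ℝ, 1 ≤ L ∧ ∀ t : ℝ≥0, f (2 * t) ≤ (L : EReal) * (f t + 1)

/-- For functions with values in `[0, +∞)`: `f t = O (g t)` as `t → +∞`. -/
def FunBigO (f g : ℝ≥0 → EReal) : Prop :=
  ∃ C : ℝ, 0 < C ∧ ∀ᶠ t : ℝ≥0 in atTop, f t ≤ (C : EReal) * g t

/-- Equivalence of weight functions. -/
def FunEquiv (f g : ℝ≥0 → EReal) : Prop := FunBigO f g ∧ FunBigO g f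

end

end ConjWeight

namespace ConjWeight

/-! ### Quotients and growth comparison -/

/-! Everything is governed by ν_p = μ_p / p. Since α(μ) < 1, there are α < 1 and H with ν_q ≤ H
(q/p)^(α-1) ν_p for 1 ≤ p ≤ q; in particular ν is almost decreasing, which is (1).

Almost monotonicity alone puts sup_{q ≥ p} ν_q within a factor H of ν_p, so λ and μ are comparable
and 𝐌 ≈ 𝐋; it also gives moderate growth, by comparing M_{p+q} with a binomial coefficient times M_p
M_q.

The power decay gives k with 2ν_q ≤ ν_p whenever q ≥ kp. As the quotients of 𝐌* are 1/ν_p, they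
double between p and kp, and (ω₁) for ω_{𝐌*} follows (`IsWeightSequence.omega1_assocFun`).

Finally ω_{𝐌*}(s) ≤ ω*_𝐌(s) ≤ ω_{𝐌*}(2s) + log 2. Both bounds rest on the fact that the p-th terms
of 𝐌* at s and of 𝐌 at t multiply to (st)^p / p!, which is compared with e^{st}. With (ω₁) for
ω_{𝐌*} this sandwich yields the claims on ω*_𝐌 and the equivalence (`Omega1.of_dilate`). -/

theorem quot_pos {M : ℕ → ℝ} (hM : ∀ p, 0 < M p) (p : ℕ) : 0 < quot M p := by
  cases p with
  | zero => exact one_pos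
  | succ p => exact div_pos (hM _) (hM _)

theorem quot_succ_mul {M : ℕ → ℝ} (hM : ∀ p, 0 < M p) (p : ℕ) :
    quot M (p + 1) * M p = M (p + 1) :=
  div_mul_cancel₀ _ (hM p).ne'

theorem LogConvex.quot_le_succ {M : ℕ → ℝ} (h : LogConvex M) (hM : ∀ p, 0 < M p) {p : ℕ}
    (hp : 1 ≤ p) : quot M p ≤ quot M (p + 1) := by
  obtain ⟨p, rfl⟩ := Nat.exists_eq_add_of_le' hp
  have := h (p + 1) hp
  simp only [Nat.add_sub_cancel] at this
  simp only [quot]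
  rw [div_le_div_iff₀ (hM _) (hM _)]
  nlinarith

theorem LogConvex.quot_mono {M : ℕ → ℝ} (h : LogConvex M) (hM : ∀ p, 0 < M p) {p q : ℕ}
    (hp : 1 ≤ p) (hpq : p ≤ q) : quot M p ≤ quot M q := by
  induction q, hpq using Nat.le_induction with
  | base => exact le_rfl
  | succ q hq ih => exact ih.trans (h.quot_le_succ hM (hp.trans hq))

theorem le_of_quot_le {M N : ℕ → ℝ} (hM : ∀ p, 0 < M p) (hN : ∀ p, 0 < N p) {C h : ℝ}
    (h0 : M 0 ≤ C * N 0) (hq : ∀ p, 1 ≤ p → quot M p ≤ h * quot N p) (p : ℕ) :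
    M p ≤ C * h ^ p * N p := by
  induction p with
  | zero => simpa using h0
  | succ p ih =>
    rw [← quot_succ_mul hM, ← quot_succ_mul hN]
    calc quot M (p + 1) * M p ≤ (h * quot N (p + 1)) * (C * h ^ p * N p) :=
          mul_le_mul (hq _ (by omega)) ih (hM p).le ((quot_pos hM _).le.trans (hq _ (by omega)))
      _ = _ := by ring

theorem rpow_inv_le {x y C h : ℝ} (hx : 0 ≤ x) (hy : 0 ≤ y) (hC : 1 ≤ C) (hh : 0 < h) {p : ℕ}
    (hp : 1 ≤ p) (hxy : x ≤ C * h ^ p * y) :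
    x ^ ((1 : ℝ) / p) ≤ C * h * y ^ ((1 : ℝ) / p) := by
  have hp0 : p ≠ 0 := by omega
  -- As C ≥ 1, the factor C can be moved inside the p-th power and survives the p-th root.
  have hCC : C ≤ C ^ p := le_self_pow₀ hC hp0
  have h1 : x ≤ (C * h * y ^ ((1 : ℝ) / p)) ^ p := by
    rw [mul_pow, one_div, Real.rpow_inv_natCast_pow hy hp0, mul_pow]
    refine hxy.trans ?_
    gcongr
  have h2 := Real.rpow_le_rpow hx h1 (by positivity : (0 : ℝ) ≤ 1 / p)
  rwa [one_div, Real.pow_rpow_inv_natCast (by positivity) hp0, ← one_div] at h2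

theorem seqLE_of_le {M N : ℕ → ℝ} (hM : ∀ p, 0 < M p) (hN : ∀ p, 0 < N p) {C h : ℝ}
    (hC : 1 ≤ C) (hh : 0 < h) (hMN : ∀ p, M p ≤ C * h ^ p * N p) : SeqLE M N := by
  refine ⟨C * h, ?_⟩
  rintro x ⟨p, hp, rfl⟩
  have := rpow_inv_le (y := 1) (div_pos (hM p) (hN p)).le zero_le_one hC hh hp
    (by rw [div_le_iff₀ (hN p)]; simpa using hMN p)
  simpa using this

theorem IsWeightSequence.of_le {M N : ℕ → ℝ} (hM : IsWeightSequence M) (hN : ∀ p, 0 < N p)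
    {C h : ℝ} (hC : 1 ≤ C) (hh : 0 < h) (hMN : ∀ p, M p ≤ C * h ^ p * N p) :
    IsWeightSequence N := by
  have hCh : 0 < C * h := by positivity
  refine ⟨hN, tendsto_atTop_mono' _ ?_ (hM.2.atTop_div_const hCh)⟩
  filter_upwards [eventually_ge_atTop 1] with p hp
  rw [div_le_iff₀' hCh]
  exact rpow_inv_le (hM.1 p).le (hN p).le hC hh hp (hMN p)

theorem lower_pos {M : ℕ → ℝ} (hM : ∀ p, 0 < M p) (p : ℕ) : 0 < lower M p :=
  div_pos (hM p) (by positivity)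

theorem tendsto_lower_of_le {M N : ℕ → ℝ} (hN : ∀ p, 0 < N p) (hM : ∀ p, 0 < M p)
    (hm : Tendsto (fun p : ℕ => lower M p ^ ((1 : ℝ) / p)) atTop (𝓝 0))
    {C h : ℝ} (hC : 1 ≤ C) (hh : 0 < h) (hNM : ∀ p, N p ≤ C * h ^ p * M p) :
    Tendsto (fun p : ℕ => lower N p ^ ((1 : ℝ) / p)) atTop (𝓝 0) := by
  have hlim : Tendsto (fun p : ℕ => C * h * lower M p ^ ((1 : ℝ) / p)) atTop (𝓝 0) := by
    simpa using hm.const_mul (C * h)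
  refine squeeze_zero' (.of_forall fun p => Real.rpow_nonneg (lower_pos hN p).le _) ?_ hlim
  filter_upwards [eventually_ge_atTop 1] with p hp
  refine rpow_inv_le (lower_pos hN p).le (lower_pos hM p).le hC hh hp ?_
  rw [lower, lower, ← mul_div_assoc]
  gcongr
  exact hNM p

theorem conjSeq_eq_inv (M : ℕ → ℝ) (p : ℕ) : conjSeq M p = (lower M p)⁻¹ := by
  simp [conjSeq, lower]

theorem conjSeq_pos {M : ℕ → ℝ} (hM : ∀ p, 0 < M p) (p : ℕ) : 0 < conjSeq M p :=
  div_pos (by positivity) (hM p)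

theorem isWeightSequence_conjSeq {M : ℕ → ℝ} (hM : ∀ p, 0 < M p)
    (hm : Tendsto (fun p : ℕ => lower M p ^ ((1 : ℝ) / p)) atTop (𝓝 0)) :
    IsWeightSequence (conjSeq M) := by
  refine ⟨conjSeq_pos hM, ?_⟩
  have h : Tendsto (fun p : ℕ => lower M p ^ ((1 : ℝ) / p)) atTop (𝓝[>] 0) :=
    tendsto_nhdsWithin_of_tendsto_nhds_of_eventually_within _ hm
      (.of_forall fun p => Real.rpow_pos_of_pos (lower_pos hM p) _)
  refine h.inv_tendsto_nhdsGT_zero.congr fun p => ?_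
  simp [conjSeq_eq_inv, Real.inv_rpow (lower_pos hM p).le]

theorem LogConcave.logConvex_conjSeq {M : ℕ → ℝ} (hM : ∀ p, 0 < M p)
    (h : LogConcave (lower M)) : LogConvex (conjSeq M) := by
  intro p hp
  simp only [conjSeq_eq_inv, ← mul_inv, inv_pow]
  exact inv_anti₀ (mul_pos (lower_pos hM _) (lower_pos hM _)) (h p hp)

/-- Quotients bounded by K would force M_p ≤ C K^p, hence bounded p-th roots; monotonicity turns
unboundedness into divergence. -/
theorem tendsto_quot_atTop {M : ℕ → ℝ} (hM : IsWeightSequence M) (h : LogConvex M) :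
    Tendsto (quot M) atTop atTop := by
  refine tendsto_atTop.2 fun K => ?_
  have hK : (0 : ℝ) < max K 1 := by positivity
  suffices ∃ p, 1 ≤ p ∧ K ≤ quot M p by
    obtain ⟨p, hp, hpK⟩ := this
    filter_upwards [eventually_ge_atTop p] with q hq
    exact hpK.trans (h.quot_mono hM.1 hp hq)
  by_contra! hcon
  have hle : ∀ p, M p ≤ max (M 0) 1 * (max K 1) ^ p * 1 :=
    le_of_quot_le (N := fun _ => 1) hM.1 (fun _ => one_pos) (by simp) (by
      intro p hp
      obtain ⟨p, rfl⟩ := Nat.exists_eq_add_of_le' hp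
      simpa [quot] using Or.inl (hcon (p + 1) hp).le)
  obtain ⟨p, hp1, hp⟩ := ((hM.2.eventually_gt_atTop (max (M 0) 1 * max K 1)).and
    (eventually_ge_atTop 1)).exists.imp fun _ h => h.symm
  have := rpow_inv_le (hM.1 p).le zero_le_one (le_max_right _ _) hK hp1 (hle p)
  rw [Real.one_rpow, mul_one] at this
  exact hp.not_ge this

/-! ### Sequences with prescribed quotients -/

/-- The sequence `a 0 * ⋯ * a p`. -/
noncomputable def prodSeq (a : ℕ → ℝ) (p : ℕ) : ℝ := ∏ i ∈ Finset.range (p + 1), a i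

theorem prodSeq_pos {a : ℕ → ℝ} (ha : ∀ p, 0 < a p) (p : ℕ) : 0 < prodSeq a p :=
  Finset.prod_pos fun i _ => ha i

theorem prodSeq_zero (a : ℕ → ℝ) : prodSeq a 0 = a 0 := by simp [prodSeq]

theorem prodSeq_succ (a : ℕ → ℝ) (p : ℕ) : prodSeq a (p + 1) = prodSeq a p * a (p + 1) :=
  Finset.prod_range_succ _ _

theorem quot_prodSeq {a : ℕ → ℝ} (ha : ∀ p, 0 < a p) {p : ℕ} (hp : 1 ≤ p) :
    quot (prodSeq a) p = a p := by
  obtain ⟨p, rfl⟩ := Nat.exists_eq_add_of_le' hp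
  rw [quot, prodSeq_succ, mul_div_cancel_left₀ _ (prodSeq_pos ha p).ne']

theorem logConvex_prodSeq {a : ℕ → ℝ} (ha : ∀ p, 0 < a p)
    (hmono : ∀ p, 1 ≤ p → a p ≤ a (p + 1)) : LogConvex (prodSeq a) := by
  intro p hp
  have h1 := hmono p hp
  obtain ⟨p, rfl⟩ := Nat.exists_eq_add_of_le' hp
  rw [Nat.add_sub_cancel, prodSeq_succ a (p + 1), prodSeq_succ a p]
  have := prodSeq_pos ha p
  have := ha (p + 1)
  calc (prodSeq a p * a (p + 1)) ^ 2 = prodSeq a p * (prodSeq a p * a (p + 1) * a (p + 1)) := by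
        ring
    _ ≤ _ := by gcongr

theorem logConcave_lower_prodSeq {a : ℕ → ℝ} (ha : ∀ p, 0 < a p)
    (hanti : ∀ p : ℕ, 1 ≤ p → a (p + 1) / (p + 1 : ℕ) ≤ a p / p) :
    LogConcave (lower (prodSeq a)) := by
  have key : ∀ p, lower (prodSeq a) (p + 1) = lower (prodSeq a) p * (a (p + 1) / (p + 1 : ℕ)) := by
    intro p
    rw [lower, lower, prodSeq_succ, Nat.factorial_succ]
    push_cast
    rw [div_mul_div_comm, mul_comm ((p : ℝ) + 1)]
  intro p hp
  have h1 := hanti p hp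
  obtain ⟨p, rfl⟩ := Nat.exists_eq_add_of_le' hp
  rw [Nat.add_sub_cancel, key (p + 1), key p]
  have := lower_pos (prodSeq_pos ha) p
  have : 0 < a (p + 1) / (p + 1 : ℕ) := div_pos (ha _) (by positivity)
  calc _ ≤ lower (prodSeq a) p * (lower (prodSeq a) p * (a (p + 1) / (p + 1 : ℕ)) *
        (a (p + 1) / (p + 1 : ℕ))) := by gcongr
    _ = _ := by ring

/-! ### Almost decreasing quotients -/

theorem exists_almostDecreasingWith_of_upperMatuszewska_lt_one {a : ℕ → ℝ}
    (h : upperMatuszewska a < 1) : ∃ α H : ℝ, α < 1 ∧ 1 ≤ H ∧ AlmostDecreasingWith a α H := by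
  obtain ⟨_, ⟨α, rfl, H, hH, hα⟩, hlt⟩ := sInf_lt_iff.1 h
  exact ⟨α, H, by exact_mod_cast hlt, hH, hα⟩

/-- Multiplying the defining inequality by q^(α-1) exposes the decay factor that is small when q/p
is large and α < 1. -/
theorem AlmostDecreasingWith.div_le {a : ℕ → ℝ} {α H : ℝ}
    (h : AlmostDecreasingWith a α H) {p q : ℕ} (hp : 1 ≤ p) (hpq : p ≤ q) :
    a q / q ≤ H * ((q : ℝ) / p) ^ (α - 1) * (a p / p) := by
  have hp' : (0 : ℝ) < p := by exact_mod_cast hp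
  have hq' : (0 : ℝ) < q := by exact_mod_cast hp.trans hpq
  have h1 := mul_le_mul_of_nonneg_right (h p q hp hpq) (Real.rpow_nonneg hq'.le (α - 1))
  have e1 : a q / (q : ℝ) ^ α * (q : ℝ) ^ (α - 1) = a q / q := by
    rw [Real.rpow_sub_one hq'.ne']
    have := (Real.rpow_pos_of_pos hq' α).ne'
    field_simp
  have e2 : H * (a p / (p : ℝ) ^ α) * (q : ℝ) ^ (α - 1) =
      H * ((q : ℝ) / p) ^ (α - 1) * (a p / p) := by
    rw [Real.div_rpow hq'.le hp'.le, Real.rpow_sub_one hp'.ne']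
    have := (Real.rpow_pos_of_pos hp' α).ne'
    field_simp
  rwa [e1, e2] at h1

theorem almostDecreasingWith_one_iff {a : ℕ → ℝ} {H : ℝ} :
    AlmostDecreasingWith a 1 H ↔ ∀ p q : ℕ, 1 ≤ p → p ≤ q → a q / q ≤ H * (a p / p) := by
  simp [AlmostDecreasingWith]

theorem AlmostDecreasingWith.one_of_lt {a : ℕ → ℝ} (ha : ∀ p, 0 < a p) {α H : ℝ} (hα : α < 1)
    (hH : 1 ≤ H) (h : AlmostDecreasingWith a α H) : AlmostDecreasingWith a 1 H := by
  refine almostDecreasingWith_one_iff.2 fun p q hp hpq => (h.div_le hp hpq).trans ?_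
  have hp' : (0 : ℝ) < p := by exact_mod_cast hp
  have h1 : ((q : ℝ) / p) ^ (α - 1) ≤ 1 :=
    Real.rpow_le_one_of_one_le_of_nonpos ((one_le_div hp').2 (by exact_mod_cast hpq))
      (by linarith)
  have h2 : 0 < a p / p := div_pos (ha p) hp'
  have : H * ((q : ℝ) / p) ^ (α - 1) ≤ H := mul_le_of_le_one_right (by linarith) h1
  gcongr

theorem AlmostDecreasingWith.tendsto_div {a : ℕ → ℝ} (ha : ∀ p, 0 < a p) {α H : ℝ} (hα : α < 1)
    (h : AlmostDecreasingWith a α H) : Tendsto (fun p : ℕ => a p / p) atTop (𝓝 0) := by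
  have hlim : Tendsto (fun q : ℕ => H * ((q : ℝ) / (1 : ℕ)) ^ (α - 1) * (a 1 / (1 : ℕ))) atTop
      (𝓝 0) := by
    have := (tendsto_rpow_neg_atTop (sub_pos.2 hα)).comp (tendsto_natCast_atTop_atTop (R := ℝ))
    simpa using (this.const_mul H).mul_const (a 1)
  refine squeeze_zero' (.of_forall fun p => div_nonneg (ha p).le p.cast_nonneg) ?_ hlim
  filter_upwards [eventually_ge_atTop 1] with p hp using h.div_le le_rfl hp

/-- Far apart terms of an almost decreasing sequence of order `α < 1` are separated. -/
theorem AlmostDecreasingWith.exists_separation {a : ℕ → ℝ} (ha : ∀ p, 0 < a p) {α H : ℝ}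
    (hα : α < 1) (h : AlmostDecreasingWith a α H) :
    ∃ k : ℕ, 1 ≤ k ∧ ∀ p q : ℕ, 1 ≤ p → k * p ≤ q → 2 * (a q / q) ≤ a p / p := by
  have hlim : Tendsto (fun k : ℕ => 2 * (H * (k : ℝ) ^ (α - 1))) atTop (𝓝 0) := by
    have := (tendsto_rpow_neg_atTop (sub_pos.2 hα)).comp (tendsto_natCast_atTop_atTop (R := ℝ))
    simpa using (this.const_mul H).const_mul 2
  -- Here k is taken so large that 2 H k^(α-1) ≤ 1.
  obtain ⟨k, hk, hk1⟩ := ((hlim.eventually_le_const one_pos).and (eventually_ge_atTop 1)).exists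
  refine ⟨k, hk1, fun p q hp hpq => ?_⟩
  have hp' : (0 : ℝ) < p := by exact_mod_cast hp
  have hk' : (0 : ℝ) < k := by exact_mod_cast hk1
  have hle : p ≤ q := (Nat.le_mul_of_pos_left p hk1).trans hpq
  have h1 := h.div_le hp hle
  have hH : 0 ≤ H := by
    have := h 1 1 le_rfl le_rfl
    have h2 := ha 1
    simp at this
    nlinarith
  have h2 : ((q : ℝ) / p) ^ (α - 1) ≤ (k : ℝ) ^ (α - 1) :=
    Real.rpow_le_rpow_of_nonpos hk' ((le_div_iff₀ hp').2 (by exact_mod_cast hpq)) (by linarith)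
  have h3 : 0 < a p / p := div_pos (ha p) hp'
  calc 2 * (a q / q) ≤ 2 * (H * (k : ℝ) ^ (α - 1) * (a p / p)) := by
        refine mul_le_mul_of_nonneg_left (h1.trans ?_) zero_le_two
        gcongr
    _ = 2 * (H * (k : ℝ) ^ (α - 1)) * (a p / p) := by ring
    _ ≤ a p / p := mul_le_of_le_one_left h3.le hk

/-- Raising p by one multiplies the left side of `key` by μ_{p+q+1} ≤ H μ_{p+1} (p+q+1)/(p+1), and
that fraction is exactly the ratio of consecutive binomial coefficients. The spare power of C
absorbs 1/M_0. -/
theorem moderateGrowth_of_almostDecreasingWith {M : ℕ → ℝ} (hM : ∀ p, 0 < M p) {H : ℝ}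
    (hH : 1 ≤ H) (h : AlmostDecreasingWith (quot M) 1 H) : ModerateGrowth M := by
  rw [almostDecreasingWith_one_iff] at h
  have key : ∀ p q : ℕ, M 0 * M (p + q) ≤ H ^ p * (p + q).choose p * (M p * M q) := by
    intro p q
    induction p with
    | zero => simp
    | succ p ih =>
      have h1 := h (p + 1) (p + q + 1) (by omega) (by omega)
      have hp : (0 : ℝ) < (p + 1 : ℕ) := by positivity
      have hq : (0 : ℝ) < (p + q + 1 : ℕ) := by positivity
      have hc : ((p + q + 1 : ℕ) : ℝ) * (p + q).choose p =
          (p + q + 1).choose (p + 1) * (p + 1 : ℕ) := by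
        exact_mod_cast Nat.add_one_mul_choose_eq (p + q) p
      have h2 : quot M (p + q + 1) ≤ H * quot M (p + 1) * ((p + q + 1 : ℕ) / (p + 1 : ℕ)) := by
        rw [div_le_iff₀ hq] at h1
        exact h1.trans_eq (by ring)
      have hpos := quot_pos hM (p + 1)
      rw [show p + 1 + q = p + q + 1 by ring, ← quot_succ_mul hM (p + q), ← quot_succ_mul hM p]
      calc M 0 * (quot M (p + q + 1) * M (p + q))
          = quot M (p + q + 1) * (M 0 * M (p + q)) := by ring
        _ ≤ (H * quot M (p + 1) * ((p + q + 1 : ℕ) / (p + 1 : ℕ))) *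
            (H ^ p * (p + q).choose p * (M p * M q)) :=
          mul_le_mul h2 ih (mul_pos (hM _) (hM _)).le (by positivity)
        _ = H ^ (p + 1) * (((p + q + 1 : ℕ) * (p + q).choose p) / (p + 1 : ℕ)) *
            (quot M (p + 1) * M p * M q) := by ring
        _ = _ := by rw [hc, mul_div_cancel_right₀ _ hp.ne']
  have hM0 := hM 0
  set C : ℝ := max (2 * H) (M 0)⁻¹
  have hC : 2 * H ≤ C := le_max_left _ _
  refine ⟨C, by linarith, fun p q => ?_⟩
  have hchoose : ((p + q).choose p : ℝ) ≤ 2 ^ (p + q) := by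
    exact_mod_cast Nat.choose_le_two_pow (p + q) p
  have hMM := mul_pos (hM p) (hM q)
  have hpow : H ^ p ≤ H ^ (p + q) := pow_le_pow_right₀ hH (by omega)
  have hk := key p q
  calc M (p + q) = (M 0)⁻¹ * (M 0 * M (p + q)) := by field_simp
    _ ≤ C * ((2 * H) ^ (p + q) * (M p * M q)) := by
      refine mul_le_mul (le_max_right _ _) (hk.trans ?_) (mul_pos hM0 (hM _)).le (by linarith)
      rw [mul_pow, mul_comm ((2 : ℝ) ^ _)]
      gcongr
    _ ≤ C * (C ^ (p + q) * (M p * M q)) := by gcongr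
    _ = _ := by ring

/-! ### Associated weight functions -/

theorem assocFun_le_log_iff {M : ℕ → ℝ} (t : ℝ≥0) {E : ℝ} (hE : 0 < E) :
    assocFun M t ≤ (Real.log E : EReal) ↔ ∀ p, M 0 * (t : ℝ) ^ p / M p ≤ E := by
  rw [assocFun, iSup_le_iff]
  refine forall_congr' fun p => ?_
  rw [← ENNReal.log_ofReal_of_pos hE, ENNReal.log_le_log_iff, ENNReal.ofReal_le_ofReal_iff hE.le]

theorem assocFun_mono {M : ℕ → ℝ} (hM : ∀ p, 0 < M p) : Monotone (assocFun M) := by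
  intro s t hst
  refine iSup_mono fun p => ENNReal.log_monotone (ENNReal.ofReal_le_ofReal ?_)
  have := hM 0
  have := hM p
  have hst' : (s : ℝ) ≤ t := hst
  gcongr

theorem le_assocFun {M : ℕ → ℝ} {t : ℝ≥0} (p : ℕ) (h : 0 < M 0 * (t : ℝ) ^ p / M p) :
    (Real.log (M 0 * (t : ℝ) ^ p / M p) : EReal) ≤ assocFun M t := by
  rw [← ENNReal.log_ofReal_of_pos h]
  exact le_iSup (fun p => ENNReal.log (ENNReal.ofReal (M 0 * (t : ℝ) ^ p / M p))) p

theorem assocFun_nonneg {M : ℕ → ℝ} (hM : ∀ p, 0 < M p) (t : ℝ≥0) : 0 ≤ assocFun M t := by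
  have h1 : M 0 * (t : ℝ) ^ 0 / M 0 = 1 := by simp [(hM 0).ne']
  simpa [h1] using le_assocFun (M := M) (t := t) 0 (by rw [h1]; exact one_pos)

/-- The associated function of a weight sequence is the logarithm of a pointwise supremum. -/
theorem IsWeightSequence.exists_assocFun_eq_log {M : ℕ → ℝ} (hM : IsWeightSequence M) :
    ∃ E : ℝ≥0 → ℝ, (∀ t, 1 ≤ E t) ∧ (∀ t, assocFun M t = (Real.log (E t) : EReal)) ∧
      ∀ (t : ℝ≥0) p, M 0 * (t : ℝ) ^ p / M p ≤ E t := by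
  have hbdd : ∀ t : ℝ≥0, BddAbove (Set.range fun p => M 0 * (t : ℝ) ^ p / M p) := by
    intro t
    refine Filter.IsBoundedUnder.bddAbove_range ⟨M 0, ?_⟩
    rw [eventually_map]
    -- Once M_p^(1/p) ≥ t, the p-th term is at most M_0.
    filter_upwards [hM.2.eventually_ge_atTop (t : ℝ), eventually_ge_atTop 1] with p hp hp1
    have h1 : (t : ℝ) ^ p ≤ M p := by
      have := pow_le_pow_left₀ t.coe_nonneg hp p
      rwa [one_div, Real.rpow_inv_natCast_pow (hM.1 p).le (by omega)] at this
    rw [div_le_iff₀ (hM.1 p)]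
    have := hM.1 0
    gcongr
  have hle : ∀ (t : ℝ≥0) p, M 0 * (t : ℝ) ^ p / M p ≤ ⨆ p, M 0 * (t : ℝ) ^ p / M p :=
    fun t p => le_ciSup (hbdd t) p
  have hone : ∀ t : ℝ≥0, 1 ≤ ⨆ p, M 0 * (t : ℝ) ^ p / M p := by
    intro t
    simpa [(hM.1 0).ne'] using hle t 0
  refine ⟨fun t => ⨆ p, M 0 * (t : ℝ) ^ p / M p, hone, fun t => le_antisymm ?_ ?_, hle⟩
  · exact (assocFun_le_log_iff t (one_pos.trans_le (hone t))).2 (hle t)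
  · have h0 := assocFun_nonneg hM.1 t
    induction hx : assocFun M t with
    | bot => rw [hx] at h0; exact absurd h0 (by simp)
    | top => exact le_top
    | coe x =>
      have := (assocFun_le_log_iff (M := M) t (Real.exp_pos x)).1 (by rw [Real.log_exp, hx])
      rw [EReal.coe_le_coe_iff, Real.log_le_iff_le_exp (one_pos.trans_le (hone t))]
      exact ciSup_le this

theorem IsWeightSequence.isWeightFunction_assocFun {M : ℕ → ℝ} (hM : IsWeightSequence M) :
    IsWeightFunction (assocFun M) := by
  obtain ⟨E, -, hEq, -⟩ := hM.exists_assocFun_eq_log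
  refine ⟨fun t => ⟨assocFun_nonneg hM.1 t, ?_⟩, assocFun_mono hM.1, ?_⟩
  · rw [hEq]; exact EReal.coe_lt_top _
  · have hc : 0 < M 0 / M 1 := div_pos (hM.1 0) (hM.1 1)
    have h1 : Tendsto (fun t : ℝ≥0 => Real.log (M 0 / M 1 * (t : ℝ))) atTop atTop :=
      Real.tendsto_log_atTop.comp (NNReal.tendsto_coe_atTop.2 tendsto_id |>.const_mul_atTop hc)
    refine tendsto_nhds_top_mono (EReal.tendsto_coe_nhds_top_iff.2 h1) ?_
    filter_upwards [eventually_gt_atTop 0] with t ht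
    have e : M 0 / M 1 * (t : ℝ) = M 0 * (t : ℝ) ^ 1 / M 1 := by ring
    rw [e]
    refine le_assocFun 1 ?_
    rw [← e]
    exact mul_pos hc (by exact_mod_cast ht)

/-- Write e^x = Σ 2^(-p) (2x)^p / p! and use Σ 2^(-p) = 2. This is the source of the dilation 2s and
of the additive log 2. -/
theorem exp_le_two_mul_of_forall {x B : ℝ}
    (h : ∀ p : ℕ, (2 * x) ^ p / (p.factorial : ℝ) ≤ B) : Real.exp x ≤ 2 * B := by
  have h1 : HasSum (fun p : ℕ => x ^ p / (p.factorial : ℝ)) (Real.exp x) := by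
    rw [Real.exp_eq_exp_ℝ]
    exact NormedSpace.expSeries_div_hasSum_exp x
  refine hasSum_le (fun p => ?_) h1 (hasSum_geometric_two.mul_right B)
  calc x ^ p / (p.factorial : ℝ) = (1 / 2) ^ p * ((2 * x) ^ p / p.factorial) := by
        rw [← mul_div_assoc, ← mul_pow]; congr 2; ring
    _ ≤ (1 / 2) ^ p * B := by gcongr; exact h p

/-- For log-convex `M` the terms `t ^ q / M q` at `t = μ p` are maximal for `q = p`. -/
theorem LogConvex.quot_pow_div_le {M : ℕ → ℝ} (h : LogConvex M) (hM : ∀ p, 0 < M p) {p : ℕ}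
    (hp : 1 ≤ p) (q : ℕ) : quot M p ^ q / M q ≤ quot M p ^ p / M p := by
  have hpos := quot_pos hM p
  -- The ratio of consecutive terms is μ_p / μ_{q+1}: at least 1 for q < p, at most 1 for q ≥ p.
  have hstep : ∀ q, quot M p ^ (q + 1) / M (q + 1) =
      quot M p ^ q / M q * (quot M p / quot M (q + 1)) := by
    intro q
    have h1 := (hM q).ne'
    have h2 := (hM (q + 1)).ne'
    have h3 := (quot_pos hM (q + 1)).ne'
    rw [div_mul_div_comm, ← pow_succ, mul_comm (M q), quot_succ_mul hM]
  have hf : ∀ q, 0 < quot M p ^ q / M q := fun q => div_pos (pow_pos hpos q) (hM q)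
  rcases le_total p q with hpq | hqp
  · induction q, hpq using Nat.le_induction with
    | base => exact le_rfl
    | succ q hq ih =>
      rw [hstep]
      exact (mul_le_of_le_one_right (hf q).le ((div_le_one (quot_pos hM _)).2
        (h.quot_mono hM hp (by omega)))).trans ih
  · induction hqp using Nat.decreasingInduction with
    | self => exact le_rfl
    | of_succ q hq ih =>
      refine le_trans ?_ ih
      rw [hstep]
      exact le_mul_of_one_le_right (hf q).le ((one_le_div (quot_pos hM _)).2
        (h.quot_mono hM (by omega) hq))

/-- At t = μ_p the supremum ω_𝐌(t) is attained at index p, so adding it to the p-th term of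
ω_{𝐌*}(s) gives log((st)^p / p!) ≤ st. -/
theorem assocFun_conjSeq_le_conjFun_assocFun {M : ℕ → ℝ} (hM : ∀ p, 0 < M p) (h : LogConvex M)
    (s : ℝ≥0) : assocFun (conjSeq M) s ≤ conjFun (assocFun M) s := by
  have hmax : ∀ p, ∃ t : ℝ≥0, 0 < M 0 * (t : ℝ) ^ p / M p ∧
      ∀ q, M 0 * (t : ℝ) ^ q / M q ≤ M 0 * (t : ℝ) ^ p / M p := by
    intro p
    have hM0 := hM 0
    rcases Nat.eq_zero_or_pos p with rfl | hp
    -- For p = 0 the point t = 0 works, since only the zeroth term survives there.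
    · refine ⟨0, by simp [hM0], fun q => ?_⟩
      cases q <;> simp [hM0.ne']
    · refine ⟨⟨quot M p, (quot_pos hM p).le⟩,
        div_pos (mul_pos hM0 (pow_pos (quot_pos hM p) p)) (hM p), fun q => ?_⟩
      simp only [mul_div_assoc]
      exact mul_le_mul_of_nonneg_left (h.quot_pow_div_le hM hp q) hM0.le
  refine iSup_le fun p => ?_
  rw [ENNReal.log_ofReal]
  split_ifs with hs
  · exact bot_le
  push Not at hs
  obtain ⟨t, ht0, ht⟩ := hmax p
  have h1 : assocFun M t ≤ (Real.log (M 0 * (t : ℝ) ^ p / M p) : EReal) :=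
    (assocFun_le_log_iff t ht0).2 ht
  refine le_trans ?_ (le_iSup (fun t : ℝ≥0 => (((s : ℝ) * (t : ℝ) : ℝ) : EReal) - assocFun M t) t)
  refine le_trans ?_ (EReal.sub_le_sub le_rfl h1)
  rw [← EReal.coe_sub, EReal.coe_le_coe_iff, le_sub_iff_add_le, ← Real.log_mul hs.ne' ht0.ne',
    Real.log_le_iff_le_exp (mul_pos hs ht0)]
  refine le_trans (le_of_eq ?_) (Real.pow_div_factorial_le_exp ((s : ℝ) * t) (by positivity) p)
  have h1 := (hM 0).ne'
  have h2 := (hM p).ne'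
  simp only [conjSeq, mul_pow, Nat.factorial_zero, Nat.cast_one]
  field_simp

/-- The Young conjugate of `ω_M` is dominated by a dilate of `ω_{M*}`. -/
theorem conjFun_assocFun_le {M : ℕ → ℝ} (hM : ∀ p, 0 < M p) {s : ℝ≥0} {E : ℝ} (hE : 0 < E)
    (h : ∀ p, conjSeq M 0 * ((2 * s : ℝ≥0) : ℝ) ^ p / conjSeq M p ≤ E) :
    conjFun (assocFun M) s ≤ (Real.log (2 * E) : EReal) := by
  refine iSup_le fun t => ?_
  have h0 := assocFun_nonneg hM t
  induction hx : assocFun M t with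
  | bot => rw [hx] at h0; exact absurd h0 (by simp)
  | top => simp
  | coe x =>
    have hb := (assocFun_le_log_iff (M := M) t (Real.exp_pos x)).1 (by rw [Real.log_exp, hx])
    rw [← EReal.coe_sub, EReal.coe_le_coe_iff, Real.le_log_iff_exp_le (by positivity),
      Real.exp_sub, div_le_iff₀ (Real.exp_pos x), mul_assoc]
    refine exp_le_two_mul_of_forall fun p => ?_
    have e : (2 * ((s : ℝ) * t)) ^ p / (p.factorial : ℝ) =
        (conjSeq M 0 * ((2 * s : ℝ≥0) : ℝ) ^ p / conjSeq M p) * (M 0 * (t : ℝ) ^ p / M p) := by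
      have h1 := (hM 0).ne'
      have h2 := (hM p).ne'
      simp only [conjSeq, NNReal.coe_mul, NNReal.coe_ofNat, mul_pow, Nat.factorial_zero,
        Nat.cast_one]
      field_simp
    rw [e]
    have := hM 0
    have := hM p
    exact mul_le_mul (h p) (hb p) (by positivity) hE.le

/-! ### Doubling and equivalence -/

/-- Each step of the index multiplies the term by u / `quot N i`. -/
theorem term_add_le {N : ℕ → ℝ} (hN : ∀ p, 0 < N p) {u c : ℝ} (hu : 0 ≤ u) (a j : ℕ)
    (hc : ∀ i, a < i → u / quot N i ≤ c) :
    N 0 * u ^ (a + j) / N (a + j) ≤ N 0 * u ^ a / N a * c ^ j := by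
  induction j with
  | zero => simp
  | succ j ih =>
    have hterm : ∀ p, 0 ≤ N 0 * u ^ p / N p := fun p =>
      div_nonneg (mul_nonneg (hN 0).le (pow_nonneg hu p)) (hN p).le
    have h0 : 0 ≤ u / quot N (a + j + 1) := div_nonneg hu (quot_pos hN _).le
    have h1 := hc (a + j + 1) (by omega)
    rw [← add_assoc, ← quot_succ_mul hN, pow_succ, pow_succ]
    calc N 0 * (u ^ (a + j) * u) / (quot N (a + j + 1) * N (a + j))
        = N 0 * u ^ (a + j) / N (a + j) * (u / quot N (a + j + 1)) := by
          rw [div_mul_div_comm]; ring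
      _ ≤ (N 0 * u ^ a / N a * c ^ j) * c :=
          mul_le_mul ih h1 h0 (mul_nonneg (hterm a) (pow_nonneg (h0.trans h1) j))
      _ = _ := by ring

/-- The indices are cut into blocks of length k. Past k(n+1), each factor 2t / `quot N i` is at most
t / `quot N (n + 1)`, so a whole block costs at most the k-th power of one step of the terms at t.
The initial block and the remainder p mod k are bounded crudely, and the logarithm of the total is
2k log(2K) + 3k log e. -/
theorem IsWeightSequence.omega1_assocFun {N : ℕ → ℝ} (hN : IsWeightSequence N) {K : ℝ}
    (hK : 1 ≤ K) (hmono : ∀ p, 1 ≤ p → quot N 1 ≤ K * quot N p) {k : ℕ} (hk : 1 ≤ k)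
    (hsep : ∀ p q, 1 ≤ p → k * p ≤ q → 2 * quot N p ≤ quot N q) : Omega1 (assocFun N) := by
  obtain ⟨E, hE1, hE, hEle⟩ := hN.exists_assocFun_eq_log
  have hpos := hN.1
  have hlogK : 0 ≤ Real.log (2 * K) := Real.log_nonneg (by linarith)
  refine ⟨2 * k * Real.log (2 * K) + 3 * k + 1, by
    have : 0 ≤ 2 * k * Real.log (2 * K) := by positivity
    have : (0 : ℝ) ≤ 3 * k := by positivity
    linarith, fun t => ?_⟩
  set e := E t
  have he : 1 ≤ e := hE1 t
  have hc1 : 1 ≤ 2 * K * e := by nlinarith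
  have hu : (0 : ℝ) ≤ 2 * (t : ℝ) := by positivity
  -- The term of index 1 gives t ≤ e · `quot N 1`; almost monotonicity carries this to every i.
  have hq : ∀ i, 0 < i → 2 * (t : ℝ) / quot N i ≤ 2 * K * e := by
    intro i hi
    have h1 := hEle t 1
    have h2 : N 0 * (t : ℝ) ^ 1 / N 1 = t / quot N 1 := by
      have := (hpos 0).ne'
      have := (hpos 1).ne'
      simp only [quot]
      field_simp
    rw [h2, div_le_iff₀ (quot_pos hpos 1)] at h1
    rw [div_le_iff₀ (quot_pos hpos i)]
    have h3 := hmono i hi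
    have : e * quot N 1 ≤ e * (K * quot N i) := by gcongr
    linarith
  have hblock : ∀ n, N 0 * (2 * (t : ℝ)) ^ (k * (n + 1)) / N (k * (n + 1)) ≤
      (2 * K * e) ^ k * (N 0 * (t : ℝ) ^ n / N n) ^ k := by
    intro n
    induction n with
    | zero =>
      have h0 := (hpos 0).ne'
      simpa [h0] using term_add_le hpos hu 0 k fun i hi => hq i hi
    | succ n ih =>
      have h1 := term_add_le hpos hu (k * (n + 1)) k (c := t / quot N (n + 1)) fun i hi => by
        have h2 := hsep (n + 1) i (by omega) hi.le
        rw [div_le_div_iff₀ (quot_pos hpos _) (quot_pos hpos _)]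
        have := mul_le_mul_of_nonneg_left h2 t.coe_nonneg
        linarith
      rw [show k * (n + 1 + 1) = k * (n + 1) + k by ring]
      have h3 : 0 ≤ (t : ℝ) / quot N (n + 1) := div_nonneg t.coe_nonneg (quot_pos hpos _).le
      refine h1.trans ((mul_le_mul_of_nonneg_right ih (pow_nonneg h3 k)).trans_eq ?_)
      rw [mul_assoc, ← mul_pow, ← quot_succ_mul hpos, div_mul_div_comm, pow_succ (t : ℝ) n,
        mul_comm (N n), mul_assoc (N 0)]
  have hmult : ∀ n, N 0 * (2 * (t : ℝ)) ^ (k * n) / N (k * n) ≤ (2 * K * e) ^ k * e ^ k := by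
    intro n
    cases n with
    | zero =>
      simpa [(hpos 0).ne'] using one_le_mul_of_one_le_of_one_le (one_le_pow₀ hc1 (n := k))
        (one_le_pow₀ he (n := k))
    | succ n =>
      refine (hblock n).trans ?_
      have : 0 ≤ N 0 * (t : ℝ) ^ n / N n :=
        div_nonneg (mul_nonneg (hpos 0).le (by positivity)) (hpos n).le
      gcongr
      exact hEle t n
  have hall : ∀ p, N 0 * ((2 * t : ℝ≥0) : ℝ) ^ p / N p ≤
      (2 * K * e) ^ k * e ^ k * (2 * K * e) ^ k := by
    intro p
    have h1 := term_add_le hpos hu (k * (p / k)) (p % k) fun i hi => hq i (by omega)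
    rw [Nat.div_add_mod] at h1
    simp only [NNReal.coe_mul, NNReal.coe_ofNat]
    refine h1.trans (mul_le_mul (hmult _) ?_ (by positivity) (by positivity))
    exact pow_le_pow_right₀ hc1 (Nat.mod_lt _ hk).le
  refine ((assocFun_le_log_iff (2 * t) (by positivity)).2 hall).trans ?_
  rw [hE]
  norm_cast
  have hK0 : 2 * K ≠ 0 := by positivity
  have he0 : e ≠ 0 := by positivity
  have hle : 0 ≤ Real.log e := Real.log_nonneg he
  rw [Real.log_mul (by positivity) (by positivity), Real.log_mul (by positivity) (by positivity),
    Real.log_pow, Real.log_pow, Real.log_mul hK0 he0]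
  have h1 : 0 ≤ 2 * k * Real.log (2 * K) * Real.log e := by positivity
  have h2 : (0 : ℝ) ≤ k := by positivity
  push_cast
  linarith

theorem IsWeightFunction.of_le {f g : ℝ≥0 → EReal} (hf : IsWeightFunction f) (hg : Monotone g)
    (hfg : ∀ t, f t ≤ g t) (hlt : ∀ t, g t < ⊤) : IsWeightFunction g :=
  ⟨fun t => ⟨(hf.1 t).1.trans (hfg t), hlt t⟩, hg,
    tendsto_nhds_top_mono hf.2.2 (.of_forall hfg)⟩

theorem conjFun_mono (f : ℝ≥0 → EReal) : Monotone (conjFun f) := by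
  intro s t hst
  refine iSup_mono fun u => EReal.sub_le_sub ?_ le_rfl
  have : (s : ℝ) ≤ t := hst
  rw [EReal.coe_le_coe_iff]
  gcongr

theorem IsWeightFunction.exists_coe {f : ℝ≥0 → EReal} (hf : IsWeightFunction f) :
    ∃ F : ℝ≥0 → ℝ, (∀ t, 0 ≤ F t) ∧ f = fun t => (F t : EReal) := by
  have h : ∀ t, ((f t).toReal : EReal) = f t := fun t =>
    EReal.coe_toReal (hf.1 t).2.ne (ne_of_gt (EReal.bot_lt_zero.trans_le (hf.1 t).1))
  exact ⟨fun t => (f t).toReal, fun t => EReal.toReal_nonneg (hf.1 t).1,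
    funext fun t => (h t).symm⟩

/-- A function squeezed between `f` and a dilate of `f` inherits the doubling condition and is
equivalent to `f`. -/
theorem Omega1.of_dilate {f g : ℝ≥0 → EReal} (hf : IsWeightFunction f) (hg : IsWeightFunction g)
    (h1 : Omega1 f) (hfg : ∀ t, f t ≤ g t) {c : ℝ} (hc : 0 ≤ c)
    (hgf : ∀ t, g t ≤ f (2 * t) + (c : EReal)) : Omega1 g ∧ FunEquiv f g := by
  have htop := hf.2.2
  obtain ⟨F, hF, rfl⟩ := hf.exists_coe
  obtain ⟨G, hG, rfl⟩ := hg.exists_coe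
  obtain ⟨L, hL, h1⟩ := h1
  beta_reduce at h1 hfg hgf
  norm_cast at h1 hfg hgf
  -- The constant comes from G(2t) ≤ F(4t) + c, followed by two doublings of F and F ≤ G.
  refine ⟨⟨L * (L + 1) + c + 1, by nlinarith, fun t => ?_⟩, ⟨1, one_pos, .of_forall fun t => ?_⟩,
    2 * L + c, by linarith, ?_⟩
  · beta_reduce
    norm_cast
    have a1 := hgf (2 * t)
    have a2 := h1 (2 * t)
    have a3 : L * (F (2 * t) + 1) ≤ L * (L * (G t + 1) + 1) := by
      have b1 := (h1 t).trans (mul_le_mul_of_nonneg_left (add_le_add_left (hfg t) 1)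
        (by linarith))
      gcongr
    have a4 := hG t
    have a5 : 0 ≤ L * G t := by positivity
    have a6 : 0 ≤ c * G t := by positivity
    linarith
  · beta_reduce
    norm_cast
    linarith [hfg t]
  -- Where F ≥ 1, the additive constants L and c are absorbed into multiples of F.
  · filter_upwards [(EReal.tendsto_coe_nhds_top_iff.1 htop).eventually_ge_atTop 1] with t ht
    norm_cast
    have a1 := hgf t
    have a2 := h1 t
    have a3 : L * 1 ≤ L * F t := by gcongr
    have a4 : c * 1 ≤ c * F t := by gcongr
    linarith

theorem quot_conjSeq {M : ℕ → ℝ} (hM : ∀ p, 0 < M p) {p : ℕ} (hp : 1 ≤ p) :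
    quot (conjSeq M) p = (quot M p / p)⁻¹ := by
  obtain ⟨p, rfl⟩ := Nat.exists_eq_add_of_le' hp
  have h1 := (hM p).ne'
  have h2 := (hM (p + 1)).ne'
  simp only [quot, conjSeq, Nat.factorial_succ]
  push_cast
  field_simp

theorem omega1_assocFun_conjSeq {M : ℕ → ℝ} (hM : ∀ p, 0 < M p)
    (hm : Tendsto (fun p : ℕ => lower M p ^ ((1 : ℝ) / p)) atTop (𝓝 0)) {α H : ℝ} (hα : α < 1)
    (hH : 1 ≤ H) (h : AlmostDecreasingWith (quot M) α H) : Omega1 (assocFun (conjSeq M)) := by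
  have hν : ∀ p : ℕ, 1 ≤ p → 0 < quot M p / p := fun p hp =>
    div_pos (quot_pos hM p) (by exact_mod_cast hp)
  obtain ⟨k, hk, hsep⟩ := h.exists_separation (quot_pos hM) hα
  have h1 := almostDecreasingWith_one_iff.1 (h.one_of_lt (quot_pos hM) hα hH)
  refine (isWeightSequence_conjSeq hM hm).omega1_assocFun hH (fun p hp => ?_) hk
    fun p q hp hpq => ?_
  · rw [quot_conjSeq hM le_rfl, quot_conjSeq hM hp, ← div_eq_mul_inv,
      le_div_iff₀ (hν p hp), ← div_eq_inv_mul, div_le_iff₀ (hν 1 le_rfl)]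
    exact h1 1 p le_rfl hp
  · have hq : 1 ≤ q := (Nat.mul_pos hk hp).trans_le hpq
    rw [quot_conjSeq hM hq, quot_conjSeq hM hp, ← div_eq_mul_inv, div_le_iff₀ (hν p hp),
      ← div_eq_inv_mul, le_div_iff₀ (hν q hq)]
    exact hsep p q hp hpq

/-! ### The regularised sequence -/

section Reg

variable {M : ℕ → ℝ} {H : ℝ}

theorem bddAbove_quot_div (h : AlmostDecreasingWith (quot M) 1 H) {p : ℕ} (hp : 1 ≤ p) :
    BddAbove (Set.range fun q : {q : ℕ // p ≤ q} => quot M q / ((q : ℕ) : ℝ)) :=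
  ⟨H * (quot M p / p), by
    rintro _ ⟨q, rfl⟩
    exact almostDecreasingWith_one_iff.1 h p q hp q.2⟩

theorem regQuot_div {p : ℕ} (hp : 1 ≤ p) :
    regQuot M H p / p = H⁻¹ * ⨆ q : {q : ℕ // p ≤ q}, quot M q / ((q : ℕ) : ℝ) := by
  have : (p : ℝ) ≠ 0 := by positivity
  rw [regQuot, if_neg (by omega)]
  field_simp

/-- The factor H⁻¹ in λ cancels the loss in (1); conversely, the entry q = p of the supremum gives μ
≤ Hλ. -/
theorem regQuot_le (hH : 1 ≤ H) (h : AlmostDecreasingWith (quot M) 1 H) {p : ℕ} (hp : 1 ≤ p) :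
    regQuot M H p ≤ quot M p := by
  have hp' : (0 : ℝ) < p := by exact_mod_cast hp
  rw [← div_le_div_iff_of_pos_right hp', regQuot_div hp, inv_mul_le_iff₀ (by positivity)]
  have : Nonempty {q : ℕ // p ≤ q} := ⟨⟨p, le_rfl⟩⟩
  exact ciSup_le fun q => almostDecreasingWith_one_iff.1 h p q hp q.2

theorem quot_le_regQuot (hH : 1 ≤ H) (h : AlmostDecreasingWith (quot M) 1 H) {p : ℕ}
    (hp : 1 ≤ p) : quot M p ≤ H * regQuot M H p := by
  have hp' : (0 : ℝ) < p := by exact_mod_cast hp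
  have hH' : H ≠ 0 := by positivity
  rw [← div_le_div_iff_of_pos_right hp', mul_div_assoc, regQuot_div hp, mul_inv_cancel_left₀ hH']
  exact le_ciSup (bddAbove_quot_div h hp) ⟨p, le_rfl⟩

theorem regQuot_pos (hM : ∀ p, 0 < M p) (hH : 1 ≤ H) (h : AlmostDecreasingWith (quot M) 1 H)
    (p : ℕ) : 0 < regQuot M H p := by
  rcases Nat.eq_zero_or_pos p with rfl | hp
  · simp [regQuot]
  · have := (quot_pos hM p).trans_le (quot_le_regQuot hH h hp)
    exact pos_of_mul_pos_right this (by linarith)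

theorem regQuot_div_anti (hH : 1 ≤ H) (h : AlmostDecreasingWith (quot M) 1 H) {p q : ℕ}
    (hp : 1 ≤ p) (hpq : p ≤ q) : regQuot M H q / q ≤ regQuot M H p / p := by
  rw [regQuot_div hp, regQuot_div (hp.trans hpq)]
  have : Nonempty {r : ℕ // q ≤ r} := ⟨⟨q, le_rfl⟩⟩
  have : (⨆ r : {r : ℕ // q ≤ r}, quot M r / ((r : ℕ) : ℝ)) ≤
      ⨆ r : {r : ℕ // p ≤ r}, quot M r / ((r : ℕ) : ℝ) :=
    ciSup_le fun r => le_ciSup (bddAbove_quot_div h hp) ⟨r, hpq.trans r.2⟩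
  gcongr

/-- For q > p, the entry ν_q also occurs in the next supremum, with the larger factor p + 1. The
entry q = p is handled by log-convexity: p ν_p = μ_p ≤ μ_{p+1} = (p+1) ν_{p+1}. -/
theorem regQuot_le_succ (hM : ∀ p, 0 < M p) (hlc : LogConvex M) (hH : 1 ≤ H)
    (h : AlmostDecreasingWith (quot M) 1 H) {p : ℕ} (hp : 1 ≤ p) :
    regQuot M H p ≤ regQuot M H (p + 1) := by
  have hp' : (0 : ℝ) < p := by exact_mod_cast hp
  have hp1 : (0 : ℝ) < (p + 1 : ℕ) := by positivity
  rw [regQuot, regQuot, if_neg (by omega), if_neg (by omega), mul_assoc, mul_assoc]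
  refine mul_le_mul_of_nonneg_left ?_ (by positivity)
  have : Nonempty {q : ℕ // p ≤ q} := ⟨⟨p, le_rfl⟩⟩
  rw [← le_div_iff₀' hp']
  have hS : ∀ r : ℕ, p + 1 ≤ r → quot M r / r ≤
      ⨆ q : {q : ℕ // p + 1 ≤ q}, quot M q / ((q : ℕ) : ℝ) := fun r hr =>
    le_ciSup (bddAbove_quot_div h (Nat.le_add_left 1 p)) ⟨r, hr⟩
  refine ciSup_le fun q => ?_
  rw [le_div_iff₀' hp']
  rcases q.2.eq_or_lt with hq | hq
  · rw [← hq, mul_div_cancel₀ _ hp'.ne']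
    refine (hlc.quot_le_succ hM hp).trans ?_
    rw [← div_le_iff₀' hp1]
    exact hS _ le_rfl
  · have h0 : 0 ≤ quot M q / ((q : ℕ) : ℝ) := div_nonneg (quot_pos hM _).le (by positivity)
    refine mul_le_mul ?_ (hS q hq) h0 hp1.le
    push_cast
    linarith

end Reg

/-! ### Normalising finitely many quotients -/

section Reg

variable {M : ℕ → ℝ} {H : ℝ}

theorem regSeq_eq_prodSeq (M : ℕ → ℝ) (H : ℝ) : regSeq M H = prodSeq (regQuot M H) := rfl

/-- Sequences whose quotients are comparable up to constants are equivalent. -/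
theorem exists_le_and_le {N : ℕ → ℝ} (hM : ∀ p, 0 < M p) (hN : ∀ p, 0 < N p) {h : ℝ}
    (hMN : ∀ p, 1 ≤ p → quot M p ≤ h * quot N p) :
    ∃ C : ℝ, 1 ≤ C ∧ ∀ p, M p ≤ C * h ^ p * N p := by
  refine ⟨max 1 (M 0 / N 0), le_max_left _ _, le_of_quot_le hM hN ?_ hMN⟩
  rw [← div_le_iff₀ (hN 0)]
  exact le_max_right _ _

theorem exists_bound_of_eventuallyEq {a b : ℕ → ℝ} (ha : ∀ p, 0 < a p) (hb : ∀ p, 0 < b p)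
    (hab : ∀ᶠ p in atTop, a p = b p) : ∃ K : ℝ, 0 < K ∧ ∀ p, a p ≤ K * b p := by
  have hbdd : BddAbove (Set.range fun p => a p / b p) := by
    refine Filter.IsBoundedUnder.bddAbove_range ⟨1, ?_⟩
    rw [eventually_map]
    filter_upwards [hab] with p hp
    rw [hp, div_self (hb p).ne']
  obtain ⟨K, hK⟩ := hbdd
  have hle : ∀ p, a p / b p ≤ K := fun p => hK ⟨p, rfl⟩
  exact ⟨K, (div_pos (ha 0) (hb 0)).trans_le (hle 0), fun p => (div_le_iff₀ (hb p)).1 (hle p)⟩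

/-- The quotients `min p (max (λ p) 1)`, with value `1` at `p = 0`. -/
noncomputable def normQuot (a : ℕ → ℝ) (p : ℕ) : ℝ :=
  if p = 0 then 1 else min (p : ℝ) (max (a p) 1)

theorem normQuot_of_pos (a : ℕ → ℝ) {p : ℕ} (hp : 1 ≤ p) :
    normQuot a p = min (p : ℝ) (max (a p) 1) := if_neg (by omega)

theorem normQuot_pos (a : ℕ → ℝ) (p : ℕ) : 0 < normQuot a p := by
  rcases Nat.eq_zero_or_pos p with rfl | hp
  · simp [normQuot]
  · rw [normQuot_of_pos a hp]
    have : (0 : ℝ) < p := by exact_mod_cast hp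
    positivity

theorem normQuot_one (a : ℕ → ℝ) : normQuot a 1 = 1 := by simp [normQuot]

theorem normQuot_le_succ {a : ℕ → ℝ} {p : ℕ} (hp : 1 ≤ p) (h : a p ≤ a (p + 1)) :
    normQuot a p ≤ normQuot a (p + 1) := by
  rw [normQuot_of_pos a hp, normQuot_of_pos a (by omega)]
  push_cast
  exact min_le_min (by linarith) (max_le_max h le_rfl)

/-- After division by p the truncation reads min(1, max(a_p / p, 1/p)), and every ingredient is
non-increasing. -/
theorem normQuot_div_anti {a : ℕ → ℝ} {p : ℕ} (hp : 1 ≤ p)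
    (h : a (p + 1) / (p + 1 : ℕ) ≤ a p / p) :
    normQuot a (p + 1) / (p + 1 : ℕ) ≤ normQuot a p / p := by
  have hp' : (0 : ℝ) < p := by exact_mod_cast hp
  have hp1 : (0 : ℝ) < (p + 1 : ℕ) := by positivity
  rw [normQuot_of_pos a hp, normQuot_of_pos a (by omega), ← min_div_div_right hp1.le,
    ← min_div_div_right hp'.le, ← max_div_div_right hp1.le, ← max_div_div_right hp'.le,
    div_self hp'.ne', div_self hp1.ne']
  refine min_le_min le_rfl (max_le_max h ?_)
  exact one_div_le_one_div_of_le hp' (by push_cast; linarith)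

/-- Changing finitely many quotients of a log-convex weight sequence with log-concave `M p / p!`
gives a normalised one. -/
theorem exists_normalised {a : ℕ → ℝ} (ha : ∀ p, 0 < a p)
    (hmono : ∀ p, 1 ≤ p → a p ≤ a (p + 1))
    (hanti : ∀ p : ℕ, 1 ≤ p → a (p + 1) / (p + 1 : ℕ) ≤ a p / p)
    (hM : IsWeightSequence M) (hm : Tendsto (fun p : ℕ => lower M p ^ ((1 : ℝ) / p)) atTop (𝓝 0))
    {h k : ℝ} (hh : 0 < h) (hk : 0 < k) (hMa : ∀ p, 1 ≤ p → quot M p ≤ h * a p)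
    (haM : ∀ p, 1 ≤ p → a p ≤ k * quot M p) (h1 : ∀ᶠ p in atTop, 1 ≤ a p)
    (h2 : ∀ᶠ p : ℕ in atTop, a p ≤ p) :
    ∃ L : ℕ → ℝ, (∀ᶠ p : ℕ in atTop, quot L p = a p) ∧ L 0 = 1 ∧ L 1 = 1 ∧
      LogConcave (lower L) ∧ SeqEquiv M L ∧ InLC L ∧ InLC (conjSeq L) := by
  have hb := normQuot_pos a
  have hL := prodSeq_pos hb
  -- Eventually 1 ≤ a_p ≤ p, so neither truncation acts.
  have hev : ∀ᶠ p in atTop, normQuot a p = a p := by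
    filter_upwards [h1, h2, eventually_ge_atTop 1] with p hp1 hp2 hp
    rw [normQuot_of_pos a hp, max_eq_left hp1, min_eq_right hp2]
  obtain ⟨K₁, hK₁, hle₁⟩ := exists_bound_of_eventuallyEq hb ha hev
  obtain ⟨K₂, hK₂, hle₂⟩ := exists_bound_of_eventuallyEq ha hb (hev.mono fun _ h => h.symm)
  obtain ⟨C₁, hC₁, hML⟩ := exists_le_and_le (N := prodSeq (normQuot a)) (h := h * K₂) hM.1 hL
    fun p hp => by
      rw [quot_prodSeq hb hp, mul_assoc]
      exact (hMa p hp).trans (mul_le_mul_of_nonneg_left (hle₂ p) hh.le)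
  obtain ⟨C₂, hC₂, hLM⟩ := exists_le_and_le (M := prodSeq (normQuot a)) (h := K₁ * k) hL hM.1
    fun p hp => by
      rw [quot_prodSeq hb hp, mul_assoc]
      exact (hle₁ p).trans (mul_le_mul_of_nonneg_left (haM p hp) hK₁.le)
  have h0 : prodSeq (normQuot a) 0 = 1 := by simp [prodSeq_zero, normQuot]
  have h1 : prodSeq (normQuot a) 1 = 1 := by rw [prodSeq_succ, h0, normQuot_one, mul_one]
  have hconc : LogConcave (lower (prodSeq (normQuot a))) :=
    logConcave_lower_prodSeq hb fun p hp => normQuot_div_anti hp (hanti p hp)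
  refine ⟨prodSeq (normQuot a), ?_, h0, h1, hconc,
    ⟨seqLE_of_le hM.1 hL hC₁ (by positivity) hML, seqLE_of_le hL hM.1 hC₂ (by positivity) hLM⟩,
    ⟨hM.of_le hL hC₁ (by positivity) hML,
      logConvex_prodSeq hb fun p hp => normQuot_le_succ hp (hmono p hp), h0, h1.ge⟩,
    ⟨isWeightSequence_conjSeq hL (tendsto_lower_of_le hL hM.1 hm hC₂ (by positivity) hLM),
      hconc.logConvex_conjSeq hL, by simp [conjSeq, h0], by simp [conjSeq, h1]⟩⟩
  filter_upwards [hev, eventually_ge_atTop 1] with p hp hp1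
  rw [quot_prodSeq hb hp1, hp]

end Reg

end ConjWeight

/-! ### Proof of the theorem -/

open ConjWeight in
theorem corollary4p13 (M : ℕ → ℝ)
    (hM : ConjWeight.IsWeightSequence M) (hlc : ConjWeight.LogConvex M)
    (hm : Tendsto (fun p : ℕ => ConjWeight.lower M p ^ ((1 : ℝ) / p)) atTop (𝓝 0))
    (hα : ConjWeight.upperMatuszewska (ConjWeight.quot M) < 1) :
    -- `μ p / p` is almost decreasing, and the regularised sequence has all listed properties
    ((∃ H : ℝ, 1 ≤ H ∧ ConjWeight.AlmostDecreasingWith (ConjWeight.quot M) 1 H) ∧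
      ∀ H : ℝ, 1 ≤ H → ConjWeight.AlmostDecreasingWith (ConjWeight.quot M) 1 H →
        ConjWeight.regSeq M H 0 = 1 ∧
        ConjWeight.LogConcave (ConjWeight.lower (ConjWeight.regSeq M H)) ∧
        (∀ p q : ℕ, 1 ≤ p → p ≤ q →
          ConjWeight.regQuot M H q / q ≤ ConjWeight.regQuot M H p / p) ∧
        ConjWeight.SeqEquiv M (ConjWeight.regSeq M H) ∧
        Tendsto (fun p : ℕ => ConjWeight.lower (ConjWeight.regSeq M H) p ^ ((1 : ℝ) / p))
          atTop (𝓝 0) ∧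
        ConjWeight.IsWeightSequence (ConjWeight.regSeq M H) ∧
        ConjWeight.LogConvex (ConjWeight.regSeq M H) ∧
        ∃ L : ℕ → ℝ,
          (∀ᶠ p : ℕ in atTop, ConjWeight.quot L p = ConjWeight.regQuot M H p) ∧
          L 0 = 1 ∧ L 1 = 1 ∧
          ConjWeight.LogConcave (ConjWeight.lower L) ∧
          ConjWeight.SeqEquiv M L ∧
          ConjWeight.InLC L ∧ ConjWeight.InLC (ConjWeight.conjSeq L)) ∧
    -- both functions are well-defined and satisfy the doubling condition
    (ConjWeight.IsWeightFunction (ConjWeight.conjFun (ConjWeight.assocFun M)) ∧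
      ConjWeight.IsWeightFunction (ConjWeight.assocFun (ConjWeight.conjSeq M)) ∧
      ConjWeight.Omega1 (ConjWeight.conjFun (ConjWeight.assocFun M)) ∧
      ConjWeight.Omega1 (ConjWeight.assocFun (ConjWeight.conjSeq M))) ∧
    -- they are equivalent
    ConjWeight.FunEquiv (ConjWeight.assocFun (ConjWeight.conjSeq M))
      (ConjWeight.conjFun (ConjWeight.assocFun M)) ∧
    -- moderate growth
    ConjWeight.ModerateGrowth M := by
  obtain ⟨α, H₀, hα1, hH₀, hdec⟩ := exists_almostDecreasingWith_of_upperMatuszewska_lt_one hα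
  have hpos := hM.1
  have hone := hdec.one_of_lt (quot_pos hpos) hα1 hH₀
  refine ⟨⟨⟨H₀, hH₀, hone⟩, fun H hH h => ?_⟩, ?_⟩
  · have ha := regQuot_pos hpos hH h
    have hmono := fun p hp => regQuot_le_succ (p := p) hpos hlc hH h hp
    have hanti := fun p q hp hpq => regQuot_div_anti (p := p) (q := q) hH h hp hpq
    have hanti' := fun p hp => hanti p (p + 1) hp (Nat.le_succ p)
    have hle := fun p hp => regQuot_le (p := p) hH h hp
    have hge := fun p hp => quot_le_regQuot (p := p) hH h hp
    have hH0 : 0 < H := one_pos.trans_le hH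
    have hL := prodSeq_pos ha
    obtain ⟨C₁, hC₁, hML⟩ := exists_le_and_le (N := prodSeq (regQuot M H)) (h := H) hpos hL
      fun p hp => by rw [quot_prodSeq ha hp]; exact hge p hp
    obtain ⟨C₂, hC₂, hLM⟩ := exists_le_and_le (M := prodSeq (regQuot M H)) (h := 1) hL hpos
      fun p hp => by rw [quot_prodSeq ha hp, one_mul]; exact hle p hp
    rw [regSeq_eq_prodSeq]
    refine ⟨by simp [prodSeq_zero, regQuot], logConcave_lower_prodSeq ha hanti', hanti,
      ⟨seqLE_of_le hpos hL hC₁ hH0 hML, seqLE_of_le hL hpos hC₂ one_pos hLM⟩,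
      tendsto_lower_of_le hL hpos hm hC₂ one_pos hLM, hM.of_le hL hC₁ hH0 hML,
      logConvex_prodSeq ha hmono,
      exists_normalised ha hmono hanti' hM hm hH0 one_pos hge (by simpa using hle) ?_ ?_⟩
    -- Eventually H ≤ μ_p ≤ Hλ_p, hence λ_p ≥ 1.
    · filter_upwards [(tendsto_quot_atTop hM hlc).eventually_ge_atTop H, eventually_ge_atTop 1]
        with p hp hp1
      have := hp.trans (hge p hp1)
      exact (le_mul_iff_one_le_right hH0).1 this
    -- Since ν_p → 0, eventually λ_p ≤ μ_p ≤ p.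
    · filter_upwards [(hdec.tendsto_div (quot_pos hpos) hα1).eventually_le_const one_pos,
        eventually_ge_atTop 1] with p hp hp1
      rw [div_le_one (by exact_mod_cast hp1)] at hp
      exact (hle p hp1).trans hp
  · have hN := isWeightSequence_conjSeq hpos hm
    have hf := hN.isWeightFunction_assocFun
    have hω := omega1_assocFun_conjSeq hpos hm hα1 hH₀ hdec
    have hfg := assocFun_conjSeq_le_conjFun_assocFun hpos hlc
    obtain ⟨E, hE1, hE, hEle⟩ := hN.exists_assocFun_eq_log
    have hup : ∀ s, conjFun (assocFun M) s ≤ (Real.log (2 * E (2 * s)) : EReal) := fun s =>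
      conjFun_assocFun_le hpos (one_pos.trans_le (hE1 _)) (hEle (2 * s))
    have hg : IsWeightFunction (conjFun (assocFun M)) :=
      hf.of_le (conjFun_mono _) hfg fun s => (hup s).trans_lt (EReal.coe_lt_top _)
    obtain ⟨h1, h2⟩ := hω.of_dilate hf hg hfg (Real.log_nonneg one_le_two) fun s => by
      rw [hE, ← EReal.coe_add, add_comm,
        ← Real.log_mul two_ne_zero (one_pos.trans_le (hE1 _)).ne']
      exact hup s
    exact ⟨⟨hg, hf, h1, hω⟩, h2, moderateGrowth_of_almostDecreasingWith hpos hH₀ hone⟩
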